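/- Let $n,k,r,\delta,a$ be integers with $\delta\ge 2$, $a>0$ and $r<k\le n-a(\delta-1)$, and let $s_1\le s_2\le\dots\le s_a$ be positive integers with $n=\sum_{j=1}^a s_j$ and $\delta\le s_j\le r+\delta-1$ for all $j$. There is a unique integer $z\ge 0$ such that \[\sum_{j=1}^{z}(s_j-\delta+1)\le k-1\quad\text{and}\quad \sum_{j=1}^{z+1}(s_j-\delta+1)>k-1 .\] For every $\varepsilon>0$ there is a $Q$, depending only on $\varepsilon$ and the parameters above, such that the following holds for every prime power $q\ge Q$. Let $B_1,\dots,B_a$ be any matrices over $\mathbb F_q$, with $B_j$ of size $(s_j-\delta+1)\times(\delta-1)$, all of whose square submatrices are invertible. Let $E$ be a $k\times(n-a(\delta-1))$ matrix whose entries are independent uniform random variables over $\mathbb F_q$, split into consecutive blocks $E=(E_1|\dots|E_a)$ with $E_j$ of size $k\times(s_j-\delta+1)$, and put \[G=(E\,|\,E_1B_1\,|\,E_2B_2\,|\,\dots\,|\,E_aB_a).\] Then with probability at least $1-\varepsilon$ the matrix $G$ is a generator matrix (that is, its rows form a basis) of a $k$-dimensional linear code $C\subseteq\mathbb F_q^n$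 which has all-symbol $(r,\delta)$-locality and minimum Hamming distance \[d\ge n-k-z(\delta-1)+1 .\] In other words, the probability of this event tends to $1$ as $q\to\infty$, uniformly in the choice of $B_1,\dots,B_a$. Here $C$ has all-symbol $(r,\delta)$-locality if every $i\in\{1,\dots,n\}$ lies in a set $S\subseteq\{1,\dots,n\}$ with $|S|\le r+\delta-1$ such that the restriction of $C$ to the coordinates in $S$ has minimum Hamming distance at least $\delta$. The minimum distance of a code is the least Hamming distance between two distinct codewords ($\infty$ if there is only one codeword). -/

import Mathlib

open MeasureTheory ProbabilityTheory

/-- The minimum Hamming distance of a code `C` with coordinates indexed by `ι`: the infimum of the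
distances of pairs of distinct codewords (so `⊤` if there is no such pair). -/
noncomputable def minDist {ι F : Type*} [Fintype ι] [DecidableEq F] (C : Set (ι → F)) : ℕ∞ :=
  ⨅ u ∈ C, ⨅ v ∈ C, ⨅ _ : u ≠ v, (hammingDist u v : ℕ∞)

/-- The restriction (projection) of a code to the coordinates in `S`. -/
def restrictCode {ι F : Type*} (C : Set (ι → F)) (S : Finset ι) : Set (S → F) :=
  (fun c (i : S) => c i) '' C

/-- The symbol `j` of the code `C` has `(r, δ)`-locality: it lies in a set `S` of at most
`r + δ - 1` coordinates such that `C` restricted to `S` has minimum distance at least `δ`. -/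
def HasLocality {ι F : Type*} [DecidableEq F] (C : Set (ι → F)) (r δ : ℕ) (j : ι) : Prop :=
  ∃ S : Finset ι, j ∈ S ∧ S.card ≤ r + δ - 1 ∧ (δ : ℕ∞) ≤ minDist (restrictCode C S)

/-- `C` is a linear locally repairable code of length `n`, dimension `k` and minimum distance `d`
with all-symbol `(r, δ)`-locality. -/
structure IsLinearLRC {ι F : Type*} [Fintype ι] [Field F] [DecidableEq F]
    (C : Submodule F (ι → F)) (n k d r δ : ℕ) : Prop where
  length_eq : Fintype.card ι = n
  dim_eq : Module.finrank F C = k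
  minDist_eq : minDist (C : Set (ι → F)) = d
  locality : ∀ j : ι, HasLocality (C : Set (ι → F)) r δ j

/-- The matrix `G` generates the code `C`: its rows form a basis of `C`. -/
def IsGeneratorMatrix {κ ι F : Type*} [Field F] (G : Matrix κ ι F)
    (C : Submodule F (ι → F)) : Prop :=
  LinearIndependent F G.row ∧ Submodule.span F (Set.range G.row) = C

/-- All square submatrices of `B` (any `m` rows and any `m` columns) are invertible. -/
def AllSquareSubmatricesInvertible {α β F : Type*} [Field F] (B : Matrix α β F) : Prop :=
  ∀ (m : ℕ) (f : Fin m ↪ α) (g : Fin m ↪ β), IsUnit (B.submatrix f g)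

/-- The columns of `E = (E_1 | ... | E_a)`: the column `⟨j, i⟩` is the `i`-th column of the block
`E_j`, which has `s_j - δ + 1` columns. -/
abbrev ECols {a : ℕ} (s : Fin a → ℕ) (δ : ℕ) : Type := (j : Fin a) × Fin (s j - δ + 1)

/-- The block `E_j` of `E`. -/
def blockE {a k δ : ℕ} {s : Fin a → ℕ} {F : Type*} (E : Matrix (Fin k) (ECols s δ) F)
    (j : Fin a) : Matrix (Fin k) (Fin (s j - δ + 1)) F :=
  E.submatrix id (fun i => ⟨j, i⟩)

/-- The matrix `(E_1 B_1 | ... | E_a B_a)`, with `δ - 1` columns in each block. -/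
def parityF {a k δ : ℕ} {s : Fin a → ℕ} {F : Type*} [Field F]
    (E : Matrix (Fin k) (ECols s δ) F)
    (B : (j : Fin a) → Matrix (Fin (s j - δ + 1)) (Fin (δ - 1)) F) :
    Matrix (Fin k) (Fin a × Fin (δ - 1)) F :=
  Matrix.of fun i p => (blockE E p.1 * B p.1) i p.2

/-- The matrix `G = (E | E_1 B_1 | ... | E_a B_a)`. -/
def matrixG {a k δ : ℕ} {s : Fin a → ℕ} {F : Type*} [Field F]
    (E : Matrix (Fin k) (ECols s δ) F)
    (B : (j : Fin a) → Matrix (Fin (s j - δ + 1)) (Fin (δ - 1)) F) :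
    Matrix (Fin k) (ECols s δ ⊕ Fin a × Fin (δ - 1)) F :=
  Matrix.fromCols E (parityF E B)

/-- `z` satisfies `∑_{j ≤ z} (s_j - δ + 1) ≤ k - 1 < ∑_{j ≤ z + 1} (s_j - δ + 1)`
(the blocks are numbered from `0` here, so `j ≤ z` reads `j < z`). -/
def IsBlockThreshold {a : ℕ} (s : Fin a → ℕ) (δ k z : ℕ) : Prop :=
  ∑ j ∈ Finset.univ.filter (fun j : Fin a => (j : ℕ) < z), (s j - δ + 1) ≤ k - 1 ∧
    k - 1 < ∑ j ∈ Finset.univ.filter (fun j : Fin a => (j : ℕ) < z + 1), (s j - δ + 1)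

/-! The proof is a first moment computation. Each repair group of `G` is a systematic code
`w ↦ (w | w B_j)`, which is MDS because all square submatrices of `B_j` are invertible
(`eq_zero_of_systematicEncode_eq_zero`). This yields the locality for every `E`
(`hasLocality_matrixG`), and it shows that a word of the `j`-th group, of dimension
`m_j = s_j - δ + 1`, vanishes on a set of `t_j` symbols for a fraction of `q ^ (- min t_j m_j)` of
all `w` (`card_systematicEncode_eq_zero_le`).

For a fixed `u ≠ 0` the vector `u E` is uniform, so `u G` vanishes on a set `T` of columns with
probability `q ^ (- ∑ min t_j m_j)`, where `t_j` counts the columns of `T` in the `j`-th group. If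
`T` has at least `k + z (δ - 1)` columns, the choice of `z` makes the exponent at least `k`
(`sum_tsub_add_le`), so that probability is at most `q ^ (-k)`. Summing over all `u` and `T`, the
expected number of `u ≠ 0` for which `u G` has `k + z (δ - 1)` or more zeros is at most `2 ^ n`. As
the nonzero multiples of such a `u` have the same property, their number is either zero or at least
`q - 1`, and by Markov's inequality one exists with probability at most `2 ^ n / (q - 1)`
(`card_isBad_mul_le`), a bound that tends to zero and does not depend on the `B_j`. If there is
none, the rows of `G` are independent and all nonzero codewords have weight at least
`n - k - z (δ - 1) + 1`. -/

/-! ### Systematic MDS codes -/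

/-- The systematic encoder `w ↦ (w | w B)`. -/
def systematicEncode {α β F : Type*} [Fintype α] [Field F] (B : Matrix α β F) (w : α → F) :
    α ⊕ β → F :=
  Sum.elim w (Matrix.vecMul w B)

lemma systematicEncode_sub {α β F : Type*} [Fintype α] [Field F] (B : Matrix α β F)
    (w w' : α → F) :
    systematicEncode B (w - w') = systematicEncode B w - systematicEncode B w' := by
  ext (c | c) <;> simp [systematicEncode, Matrix.sub_vecMul]

/-- Any `|α|` symbols of `(w | w B)` form an information set: a word of the MDS code that
vanishes on them is zero. -/
lemma eq_zero_of_systematicEncode_eq_zero {α β F : Type*} [Fintype α] [Field F]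
    {B : Matrix α β F} (hB : AllSquareSubmatricesInvertible B) {w : α → F}
    {T : Finset (α ⊕ β)} (hT : Fintype.card α ≤ T.card)
    (h : ∀ c ∈ T, systematicEncode B w c = 0) : w = 0 := by
  classical
  set R : Finset α := Finset.univ.filter (fun i => w i ≠ 0) with hR
  have hleft : T.toLeft ⊆ Rᶜ := by
    intro i hi
    simpa [hR, systematicEncode] using h _ (Finset.mem_toLeft.1 hi)
  have h1 := Finset.card_le_card hleft
  have h2 := Finset.card_compl_add_card R
  have h3 := T.card_toLeft_add_card_toRight
  obtain ⟨C, hC, hCR⟩ := Finset.exists_subset_card_eq (show R.card ≤ T.toRight.card by omega)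
  -- The square submatrix on the support of `w` and on as many vanishing parity symbols.
  let f : Fin R.card ↪ α := R.equivFin.symm.toEmbedding.trans (Function.Embedding.subtype _)
  let g : Fin R.card ↪ β :=
    (C.equivFinOfCardEq hCR).symm.toEmbedding.trans (Function.Embedding.subtype _)
  have hzero : Matrix.vecMul (w ∘ f) (B.submatrix f g) = 0 := by
    ext l
    have hl : g l ∈ C := ((C.equivFinOfCardEq hCR).symm l).2
    have h0 := h _ (Finset.mem_toRight.1 (hC hl))
    simp only [systematicEncode, Sum.elim_inr, Matrix.vecMul, dotProduct] at h0
    simp only [Matrix.vecMul, dotProduct, Function.comp, Matrix.submatrix_apply, Pi.zero_apply]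
    rw [← h0, ← Finset.sum_subset (Finset.subset_univ R)
      (fun i _ hi => by simp [show w i = 0 by simpa [hR] using hi]), ← Finset.sum_coe_sort R]
    exact Fintype.sum_equiv R.equivFin.symm _ _ (fun i => rfl)
  have hinj := Matrix.vecMul_injective_of_isUnit (hB _ f g)
  have hw : w ∘ f = 0 := hinj (by simpa using hzero)
  ext i
  by_contra hi
  have hiR : i ∈ R := by simpa [hR] using hi
  have := congrFun hw (R.equivFin ⟨i, hiR⟩)
  simp [f] at this
  exact hi this

/-- A systematic MDS code has at most `q ^ (|α| - |T|)` words vanishing on `T`, where the truncated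
subtraction accounts for the case `|T| ≥ |α|`. -/
lemma card_systematicEncode_eq_zero_le {α β F : Type*} [Fintype α] [Fintype β]
    [DecidableEq α] [Field F] [Fintype F] [DecidableEq F]
    {B : Matrix α β F} (hB : AllSquareSubmatricesInvertible B) (T : Finset (α ⊕ β)) :
    (Finset.univ.filter fun w : α → F => ∀ c ∈ T, systematicEncode B w c = 0).card ≤
      Fintype.card F ^ (Fintype.card α - T.card) := by
  classical
  -- Enlarge `T` to an information set; the words are determined by the symbols on the new part.
  obtain ⟨T', hTT', hT'⟩ := Finset.exists_superset_card_eq (s := T)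
    (n := max (Fintype.card α) T.card) (le_max_right _ _)
    (max_le (by simp) (Finset.card_le_univ T))
  have hcard : (T' \ T).card = Fintype.card α - T.card := by
    rw [Finset.card_sdiff_of_subset hTT', hT']; omega
  calc _ ≤ (Finset.univ : Finset (↥(T' \ T) → F)).card := by
        refine Finset.card_le_card_of_injOn (fun w c => systematicEncode B w c) (by simp) ?_
        intro w hw w' hw' heq
        simp only [Finset.coe_filter, Finset.mem_univ, true_and, Set.mem_ofPred_eq] at hw hw'
        rw [← sub_eq_zero]
        refine eq_zero_of_systematicEncode_eq_zero hB (T := T') (hT' ▸ le_max_left _ _) ?_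
        intro c hc
        rw [systematicEncode_sub, Pi.sub_apply]
        by_cases hcT : c ∈ T
        · rw [hw c hcT, hw' c hcT, sub_zero]
        · exact sub_eq_zero.2 (congrFun heq ⟨c, Finset.mem_sdiff.2 ⟨hc, hcT⟩⟩)
    _ = _ := by rw [Finset.card_univ, Fintype.card_fun, Fintype.card_coe, hcard]

/-- The Singleton bound is attained: a nonzero word of the MDS code has weight more than `|β|`. -/
lemma lt_card_systematicEncode_ne_zero {α β F : Type*} [Fintype α] [Fintype β]
    [Field F] [DecidableEq F]
    {B : Matrix α β F} (hB : AllSquareSubmatricesInvertible B) {w : α → F} (hw : w ≠ 0) :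
    Fintype.card β < (Finset.univ.filter fun c => systematicEncode B w c ≠ 0).card := by
  classical
  have h1 : (Finset.univ.filter fun c => systematicEncode B w c = 0).card < Fintype.card α := by
    by_contra! h
    exact hw (eq_zero_of_systematicEncode_eq_zero hB h (by simp))
  have h2 := Finset.card_filter_add_card_filter_not (s := (Finset.univ : Finset (α ⊕ β)))
    (fun c => systematicEncode B w c = 0)
  simp only [Finset.card_univ, Fintype.card_sum] at h2
  simp only [ne_eq]
  omega

/-! ### The block structure of the generator matrix -/

/-- The positions of the `j`-th repair group: the columns of `E_j` and those of `E_j B_j`. -/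
def blockEmb {a : ℕ} (s : Fin a → ℕ) (δ : ℕ) (j : Fin a) :
    Fin (s j - δ + 1) ⊕ Fin (δ - 1) ↪ ECols s δ ⊕ Fin a × Fin (δ - 1) where
  toFun := Sum.map (fun i => ⟨j, i⟩) (fun p => (j, p))
  inj' := Sum.map_injective.2 ⟨fun _ _ h => eq_of_heq (Sigma.mk.inj h).2,
    fun _ _ h => (Prod.ext_iff.1 h).2⟩

lemma exists_blockEmb_eq {a : ℕ} (s : Fin a → ℕ) (δ : ℕ)
    (c : ECols s δ ⊕ Fin a × Fin (δ - 1)) : ∃ j d, blockEmb s δ j d = c := by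
  rcases c with ⟨j, i⟩ | ⟨j, p⟩
  · exact ⟨j, Sum.inl i, rfl⟩
  · exact ⟨j, Sum.inr p, rfl⟩

/-- A set of columns splits into its parts in the repair groups. -/
lemma sum_card_preimage_blockEmb {a : ℕ} (s : Fin a → ℕ) (δ : ℕ)
    (T : Finset (ECols s δ ⊕ Fin a × Fin (δ - 1))) :
    ∑ j, (T.preimage (blockEmb s δ j) (blockEmb s δ j).injective.injOn).card = T.card := by
  classical
  let idx : ECols s δ ⊕ Fin a × Fin (δ - 1) → Fin a := Sum.elim Sigma.fst Prod.fst
  have hidx : ∀ j d, idx (blockEmb s δ j d) = j := by rintro j (d | d) <;> rfl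
  rw [Finset.card_eq_sum_card_fiberwise (f := idx) (t := Finset.univ) (by simp)]
  refine Finset.sum_congr rfl fun j _ => ?_
  rw [← Finset.card_map (blockEmb s δ j)]
  congr 1
  ext c
  simp only [Finset.mem_map, Finset.mem_preimage, Finset.mem_filter]
  constructor
  · rintro ⟨d, hd, rfl⟩
    exact ⟨hd, hidx j d⟩
  · rintro ⟨hc, rfl⟩
    obtain ⟨j, d, rfl⟩ := exists_blockEmb_eq s δ c
    rw [hidx]
    exact ⟨d, hc, rfl⟩

/-- On each repair group, a codeword `u G` is the systematic encoding of a block of `u E`. -/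
lemma vecMul_matrixG_blockEmb {a k δ : ℕ} {s : Fin a → ℕ} {F : Type*} [Field F]
    (E : Matrix (Fin k) (ECols s δ) F)
    (B : (j : Fin a) → Matrix (Fin (s j - δ + 1)) (Fin (δ - 1)) F) (u : Fin k → F) (j : Fin a)
    (d : Fin (s j - δ + 1) ⊕ Fin (δ - 1)) :
    Matrix.vecMul u (matrixG E B) (blockEmb s δ j d) =
      systematicEncode (B j) (fun i => Matrix.vecMul u E ⟨j, i⟩) d := by
  rcases d with i | p
  · rfl
  · change Matrix.vecMul u (blockE E j * B j) p = _
    rw [← Matrix.vecMul_vecMul]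
    rfl

/-- Every symbol of the code spanned by the rows of `G` is protected by its repair group. -/
lemma hasLocality_matrixG {a k δ r : ℕ} {s : Fin a → ℕ} {F : Type*} [Field F] [DecidableEq F]
    (hδ : 2 ≤ δ) (hs : ∀ j, δ ≤ s j ∧ s j ≤ r + δ - 1)
    (E : Matrix (Fin k) (ECols s δ) F)
    {B : (j : Fin a) → Matrix (Fin (s j - δ + 1)) (Fin (δ - 1)) F}
    (hB : ∀ j, AllSquareSubmatricesInvertible (B j))
    {C : Set (ECols s δ ⊕ Fin a × Fin (δ - 1) → F)}
    (hC : ∀ c ∈ C, ∃ u, Matrix.vecMul u (matrixG E B) = c)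
    (c : ECols s δ ⊕ Fin a × Fin (δ - 1)) : HasLocality C r δ c := by
  classical
  obtain ⟨j, d, rfl⟩ := exists_blockEmb_eq s δ c
  refine ⟨Finset.univ.map (blockEmb s δ j), by simp, ?_, ?_⟩
  · have := hs j
    simp only [Finset.card_map, Finset.card_univ, Fintype.card_sum, Fintype.card_fin]
    omega
  · refine le_iInf₂ fun v hv => le_iInf₂ fun v' hv' => le_iInf fun hne => ?_
    obtain ⟨w, hw, rfl⟩ := hv
    obtain ⟨w', hw', rfl⟩ := hv'
    obtain ⟨u, rfl⟩ := hC w hw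
    obtain ⟨u', rfl⟩ := hC w' hw'
    have hval : ∀ e, Matrix.vecMul u (matrixG E B) (blockEmb s δ j e)
          - Matrix.vecMul u' (matrixG E B) (blockEmb s δ j e) =
        systematicEncode (B j) (fun i => Matrix.vecMul (u - u') E ⟨j, i⟩) e := by
      intro e
      rw [← vecMul_matrixG_blockEmb, Matrix.sub_vecMul, Pi.sub_apply]
    have hx : (fun i => Matrix.vecMul (u - u') E ⟨j, i⟩) ≠ 0 := by
      intro h0
      apply hne
      ext ⟨e, he⟩
      obtain ⟨e, -, rfl⟩ := Finset.mem_map.1 he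
      have := hval e
      rw [h0] at this
      rw [← sub_eq_zero]
      refine this.trans ?_
      cases e <;> simp [systematicEncode]
    have hlt := lt_card_systematicEncode_ne_zero (hB j) hx
    rw [Fintype.card_fin] at hlt
    refine Nat.cast_le.2 (le_trans (by omega) (hlt.trans_le (Finset.card_le_card_of_injOn
      (fun e => ⟨blockEmb s δ j e, Finset.mem_map_of_mem _ (Finset.mem_univ e)⟩) ?_ ?_)))
    · intro e he
      simp only [Finset.coe_filter, Finset.mem_univ, true_and, Set.mem_ofPred_eq] at he ⊢
      rwa [← hval, sub_ne_zero] at he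
    · intro e _ e' _ h
      exact (blockEmb s δ j).injective (Subtype.ext_iff.1 h)

/-! ### The block threshold -/

/-- Since the block sizes increase, the first `z + 1` blocks have the smallest total size among
all families of more than `z` blocks. -/
lemma sum_filter_lt_le_sum_of_monotone {a z : ℕ} {m : Fin a → ℕ} (hm : Monotone m)
    {J : Finset (Fin a)} (hJ : z + 1 ≤ J.card) :
    ∑ j ∈ Finset.univ.filter (fun j : Fin a => (j : ℕ) < z + 1), m j ≤ ∑ j ∈ J, m j := by
  classical
  set I := Finset.univ.filter (fun j : Fin a => (j : ℕ) < z + 1) with hI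
  have hza : z < a := by
    have := Finset.card_le_univ J
    rw [Fintype.card_fin] at this
    omega
  have hIc : I.card ≤ z + 1 := by
    have := Finset.card_le_card_of_injOn (s := I) (t := Finset.range (z + 1))
      (fun j => (j : ℕ)) (by intro j hj; simpa [hI] using hj) (Fin.val_injective.injOn)
    simpa using this
  have hd : (I \ J).card ≤ (J \ I).card := Finset.card_sdiff_le_card_sdiff_iff.2 (hIc.trans hJ)
  rw [← Finset.sum_inter_add_sum_sdiff I J, ← Finset.sum_inter_add_sum_sdiff J I,
    Finset.inter_comm J I]
  refine Nat.add_le_add_left ?_ _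
  calc ∑ j ∈ I \ J, m j ≤ (I \ J).card • m ⟨z, hza⟩ :=
        Finset.sum_le_card_nsmul _ _ _ fun j hj => hm (by
          have : (j : ℕ) < z + 1 := by simpa [hI] using (Finset.mem_sdiff.1 hj).1
          exact Fin.le_def.2 (Nat.lt_succ_iff.1 this))
    _ ≤ (J \ I).card • m ⟨z, hza⟩ := by gcongr
    _ ≤ ∑ j ∈ J \ I, m j :=
        Finset.card_nsmul_le_sum _ _ _ fun j hj => hm (by
          have : ¬ (j : ℕ) < z + 1 := by simpa [hI] using (Finset.mem_sdiff.1 hj).2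
          exact Fin.le_def.2 (by simp only; omega))

/-- Among `k + z (δ - 1)` columns of `G`, taken as `t j` columns of the `j`-th group, at least `k`
are not redundant: `∑ min (t j) (m j) ≥ k`. Either at most `z` groups are
over-full, each wasting at most `e = δ - 1` columns, or more than `z` groups have full rank. -/
lemma sum_tsub_add_le {a k z e : ℕ} {m t : Fin a → ℕ} (hm : Monotone m)
    (hz : k - 1 < ∑ j ∈ Finset.univ.filter (fun j : Fin a => (j : ℕ) < z + 1), m j)
    (ht : ∀ j, t j ≤ m j + e) (hsum : k + z * e ≤ ∑ j, t j) :
    ∑ j, (m j - t j) + k ≤ ∑ j, m j := by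
  classical
  have hmin : ∑ j, (m j - t j) + ∑ j, min (t j) (m j) = ∑ j, m j := by
    rw [← Finset.sum_add_distrib]
    exact Finset.sum_congr rfl fun j _ => by omega
  suffices k ≤ ∑ j, min (t j) (m j) by omega
  set J := Finset.univ.filter (fun j => m j < t j) with hJ
  by_cases hc : z + 1 ≤ J.card
  · have h1 := sum_filter_lt_le_sum_of_monotone hm hc
    have h2 : ∑ j ∈ J, m j ≤ ∑ j, min (t j) (m j) := by
      refine le_trans (Finset.sum_le_sum fun j hj => ?_)
        (Finset.sum_le_sum_of_subset (Finset.subset_univ J))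
      have : m j < t j := by simpa [hJ] using hj
      omega
    omega
  · have h1 : ∑ j, t j ≤ ∑ j, (min (t j) (m j) + if m j < t j then e else 0) :=
      Finset.sum_le_sum fun j _ => by have := ht j; split_ifs <;> omega
    rw [Finset.sum_add_distrib, ← Finset.sum_filter, ← hJ, Finset.sum_const, smul_eq_mul] at h1
    have h2 : J.card * e ≤ z * e := Nat.mul_le_mul_right _ (by omega)
    omega

lemma sum_blockSize_add {a δ : ℕ} {s : Fin a → ℕ} (hs : ∀ j, δ ≤ s j) (hδ : 0 < δ) :
    ∑ j, (s j - δ + 1) + a * (δ - 1) = ∑ j, s j := by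
  have h : a * (δ - 1) = ∑ _j : Fin a, (δ - 1) := by simp
  rw [h, ← Finset.sum_add_distrib]
  exact Finset.sum_congr rfl fun j _ => by have := hs j; omega

lemma existsUnique_isBlockThreshold {a k δ : ℕ} {s : Fin a → ℕ}
    (hk : k - 1 < ∑ j, (s j - δ + 1)) :
    ∃ z, z < a ∧ IsBlockThreshold s δ k z ∧ ∀ z', IsBlockThreshold s δ k z' → z' = z := by
  classical
  set f : ℕ → ℕ := fun z =>
    ∑ j ∈ Finset.univ.filter (fun j : Fin a => (j : ℕ) < z), (s j - δ + 1) with hf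
  have hmono : Monotone f := fun z z' h => Finset.sum_le_sum_of_subset fun j hj => by
    simp only [Finset.mem_filter, Finset.mem_univ, true_and] at hj ⊢
    omega
  have hfa : k - 1 < f a := by simpa [hf] using hk
  have hex : ∃ z, k - 1 < f z := ⟨a, hfa⟩
  have h0 : Nat.find hex ≠ 0 := by
    intro h
    have := Nat.find_spec hex
    rw [h] at this
    simp [hf] at this
  have hle : Nat.find hex ≤ a := Nat.find_le hfa
  obtain ⟨z, hz⟩ := Nat.exists_eq_succ_of_ne_zero h0
  have hz1 : k - 1 < f (z + 1) := by have := Nat.find_spec hex; rwa [hz] at this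
  have hz0 : f z ≤ k - 1 := not_lt.1 (Nat.find_min hex (by omega))
  refine ⟨z, by omega, ⟨hz0, hz1⟩, fun z' h' => ?_⟩
  have h1 : f z' ≤ k - 1 := h'.1
  have h2 : k - 1 < f (z' + 1) := h'.2
  by_contra hne
  rcases Nat.lt_or_gt_of_ne hne with h | h
  · have := hmono (show z' + 1 ≤ z by omega); omega
  · have := hmono (show z + 1 ≤ z' by omega); omega

/-! ### Counting bad matrices -/

/-- For `u ≠ 0` the vector `u E` is uniformly distributed: the matrices `E` with `u E` in a given
set of `|V|` vectors make up a proportion of at most `|V| / q ^ |ι|`. -/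
lemma card_vecMul_mem_mul_le {κ ι F : Type*} [Fintype κ] [DecidableEq κ] [Fintype ι]
    [DecidableEq ι] [Field F] [Fintype F] [DecidableEq F]
    {u : κ → F} (hu : u ≠ 0) (V : Finset (ι → F)) :
    (Finset.univ.filter fun E : κ → ι → F => Matrix.vecMul u (Matrix.of E) ∈ V).card
        * Fintype.card F ^ Fintype.card ι ≤
      V.card * Fintype.card F ^ (Fintype.card κ * Fintype.card ι) := by
  classical
  obtain ⟨i₀, hi₀⟩ := Function.ne_iff.1 hu
  have hκ : Fintype.card {i // i ≠ i₀} + 1 = Fintype.card κ := by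
    rw [Fintype.card_subtype_compl, Fintype.card_subtype_eq]
    have : 0 < Fintype.card κ := Fintype.card_pos_iff.2 ⟨i₀⟩
    omega
  -- `E` is determined by `u E` and by its rows other than `i₀`.
  have h : (Finset.univ.filter fun E : κ → ι → F => Matrix.vecMul u (Matrix.of E) ∈ V).card ≤
      (V ×ˢ (Finset.univ : Finset ({i // i ≠ i₀} → ι → F))).card := by
    refine Finset.card_le_card_of_injOn
      (fun E => (Matrix.vecMul u (Matrix.of E), fun i => E i)) ?_ ?_
    · intro E hE
      simpa using hE
    · intro E _ E' _ hEE
      obtain ⟨h1, h2⟩ := Prod.ext_iff.1 hEE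
      have h3 : ∀ i, i ≠ i₀ → E i = E' i := fun i hi => congrFun h2 ⟨i, hi⟩
      ext i c
      by_cases hi : i = i₀
      · subst hi
        have h4 := congrFun h1 c
        simp only [Matrix.vecMul, dotProduct, Matrix.of_apply] at h4
        rw [← Finset.add_sum_erase _ _ (Finset.mem_univ i),
          ← Finset.add_sum_erase _ _ (Finset.mem_univ i),
          Finset.sum_congr rfl (g := fun x => u x * E' x c)
            (fun x hx => by rw [h3 x (Finset.ne_of_mem_erase hx)])] at h4
        exact mul_left_cancel₀ hi₀ (add_right_cancel h4)
      · rw [h3 i hi]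
  calc _ ≤ (V ×ˢ (Finset.univ : Finset ({i // i ≠ i₀} → ι → F))).card
          * Fintype.card F ^ Fintype.card ι := Nat.mul_le_mul_right _ h
    _ = _ := by
      rw [Finset.card_product, Finset.card_univ, Fintype.card_fun, Fintype.card_fun, mul_assoc,
        ← pow_mul, ← pow_add, ← hκ]
      congr 2
      ring

/-- For `u ≠ 0` and a set `T` of `k + z (δ - 1)` columns or more, `u G` vanishes on `T` for a
proportion of at most `q ^ (-k)` of the matrices `E`. -/
lemma card_vecMul_matrixG_eq_zero_mul_le {a k δ z : ℕ} {s : Fin a → ℕ} {F : Type*} [Field F]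
    [Fintype F] [DecidableEq F] (hmono : Monotone s) (hz : IsBlockThreshold s δ k z)
    {B : (j : Fin a) → Matrix (Fin (s j - δ + 1)) (Fin (δ - 1)) F}
    (hB : ∀ j, AllSquareSubmatricesInvertible (B j)) {u : Fin k → F} (hu : u ≠ 0)
    {T : Finset (ECols s δ ⊕ Fin a × Fin (δ - 1))} (hT : k + z * (δ - 1) ≤ T.card) :
    (Finset.univ.filter fun E : Fin k → ECols s δ → F =>
        ∀ c ∈ T, Matrix.vecMul u (matrixG (Matrix.of E) B) c = 0).card * Fintype.card F ^ k ≤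
      Fintype.card F ^ (k * Fintype.card (ECols s δ)) := by
  classical
  set q := Fintype.card F with hq
  have hq0 : 0 < q := Fintype.card_pos
  let Tj : (j : Fin a) → Finset (Fin (s j - δ + 1) ⊕ Fin (δ - 1)) := fun j =>
    T.preimage (blockEmb s δ j) (blockEmb s δ j).injective.injOn
  let W : (j : Fin a) → Finset (Fin (s j - δ + 1) → F) := fun j =>
    Finset.univ.filter fun w => ∀ c ∈ Tj j, systematicEncode (B j) w c = 0
  let V : Finset (ECols s δ → F) := Finset.univ.filter fun v => ∀ j, (fun i => v ⟨j, i⟩) ∈ W j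
  have hW : ∀ j, (W j).card ≤ q ^ (s j - δ + 1 - (Tj j).card) := fun j => by
    have h := card_systematicEncode_eq_zero_le (hB j) (Tj j)
    rw [Fintype.card_fin] at h
    convert h
  have hV : V.card ≤ q ^ ∑ j, (s j - δ + 1 - (Tj j).card) := by
    calc V.card ≤ (Fintype.piFinset W).card := by
          refine Finset.card_le_card_of_injOn (fun v j i => v ⟨j, i⟩) ?_ ?_
          · intro v hv
            simpa [V] using hv
          · intro v _ v' _ h
            ext ⟨j, i⟩
            exact congrFun (congrFun h j) i
      _ = ∏ j, (W j).card := Fintype.card_piFinset W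
      _ ≤ ∏ j, q ^ (s j - δ + 1 - (Tj j).card) := Finset.prod_le_prod (fun _ _ => Nat.zero_le _)
          fun j _ => hW j
      _ = _ := Finset.prod_pow_eq_pow_sum _ _ _
  have hcomb : ∑ j, (s j - δ + 1 - (Tj j).card) + k ≤ ∑ j, (s j - δ + 1) := by
    refine sum_tsub_add_le (z := z) (e := δ - 1) (fun i j h => by have := hmono h; omega) hz.2
      (fun j => ?_) ?_
    · simpa using Finset.card_le_univ (Tj j)
    · rw [sum_card_preimage_blockEmb]
      exact hT
  have hN : Fintype.card (ECols s δ) = ∑ j, (s j - δ + 1) := by simp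
  have hmain := card_vecMul_mem_mul_le hu V
  rw [Fintype.card_fin] at hmain
  have hsub : (Finset.univ.filter fun E : Fin k → ECols s δ → F =>
      ∀ c ∈ T, Matrix.vecMul u (matrixG (Matrix.of E) B) c = 0) ⊆
      Finset.univ.filter fun E : Fin k → ECols s δ → F =>
        Matrix.vecMul u (Matrix.of E) ∈ V := by
    intro E hE
    simp only [V, W, Tj, Finset.mem_filter, Finset.mem_univ, true_and, Finset.mem_preimage]
      at hE ⊢
    intro j d hd
    rw [← vecMul_matrixG_blockEmb]
    exact hE _ hd
  refine Nat.le_of_mul_le_mul_right (c := q ^ Fintype.card (ECols s δ)) ?_ (pow_pos hq0 _)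
  calc _ ≤ (Finset.univ.filter fun E : Fin k → ECols s δ → F =>
            Matrix.vecMul u (Matrix.of E) ∈ V).card * q ^ k * q ^ Fintype.card (ECols s δ) := by
        gcongr
    _ ≤ V.card * q ^ (k * Fintype.card (ECols s δ)) * q ^ k := by
        rw [mul_right_comm]; gcongr
    _ ≤ q ^ (∑ j, (s j - δ + 1 - (Tj j).card)) * q ^ (k * Fintype.card (ECols s δ)) * q ^ k := by
        gcongr
    _ = q ^ (k * Fintype.card (ECols s δ)) * q ^ (∑ j, (s j - δ + 1 - (Tj j).card) + k) := by
        rw [pow_add]; ring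
    _ ≤ _ := by
        rw [hN]
        gcongr

/-- `E` is bad if some nontrivial combination `u G` of the rows of `G` has at least `K` zeros. -/
def IsBad {a k δ : ℕ} {s : Fin a → ℕ} {F : Type*} [Field F] [DecidableEq F]
    (B : (j : Fin a) → Matrix (Fin (s j - δ + 1)) (Fin (δ - 1)) F) (K : ℕ)
    (E : Fin k → ECols s δ → F) : Prop :=
  ∃ u : Fin k → F, u ≠ 0 ∧
    K ≤ (Finset.univ.filter fun c => Matrix.vecMul u (matrixG (Matrix.of E) B) c = 0).card

open Classical in
/-- First moment bound: the bad matrices make up a proportion of at most `2 ^ n / (q - 1)`. The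
factor `q - 1` arises because all nonzero multiples of a bad row combination are bad. -/
lemma card_isBad_mul_le {a k δ z : ℕ} {s : Fin a → ℕ} {F : Type*} [Field F]
    [Fintype F] [DecidableEq F] (hmono : Monotone s) (hz : IsBlockThreshold s δ k z)
    {B : (j : Fin a) → Matrix (Fin (s j - δ + 1)) (Fin (δ - 1)) F}
    (hB : ∀ j, AllSquareSubmatricesInvertible (B j)) :
    (Finset.univ.filter fun E : Fin k → ECols s δ → F =>
        IsBad B (k + z * (δ - 1)) E).card * (Fintype.card F - 1) ≤
      2 ^ Fintype.card (ECols s δ ⊕ Fin a × Fin (δ - 1)) *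
        Fintype.card F ^ (k * Fintype.card (ECols s δ)) := by
  set q := Fintype.card F with hq
  set K := k + z * (δ - 1) with hK
  have hq0 : 0 < q := Fintype.card_pos
  let Z : (Fin k → ECols s δ → F) → (Fin k → F) →
      Finset (ECols s δ ⊕ Fin a × Fin (δ - 1)) := fun E u =>
    Finset.univ.filter fun c => Matrix.vecMul u (matrixG (Matrix.of E) B) c = 0
  have hlow : ∀ E : Fin k → ECols s δ → F, IsBad B K E → q - 1 ≤
      ((Finset.univ.filter fun u : Fin k → F => u ≠ 0).filter fun u => K ≤ (Z E u).card).card := by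
    rintro E ⟨u, hu, hKu⟩
    have hunits : (Finset.univ.filter fun t : F => t ≠ 0).card = q - 1 := by
      rw [Finset.filter_ne', Finset.card_erase_of_mem (Finset.mem_univ _), Finset.card_univ]
    rw [← hunits]
    refine Finset.card_le_card_of_injOn (fun t => t • u) ?_ ?_
    · intro t ht
      simp only [Finset.coe_filter, Finset.mem_univ, true_and, Set.mem_ofPred_eq,
        Finset.mem_filter] at ht ⊢
      refine ⟨smul_ne_zero ht hu, hKu.trans (Finset.card_le_card fun c hc => ?_)⟩
      simp only [Z, Finset.mem_filter, Finset.mem_univ, true_and] at hc ⊢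
      rw [Matrix.smul_vecMul, Pi.smul_apply, hc, smul_zero]
    · intro t _ t' _ h
      exact smul_left_injective F hu h
  have hup : ∀ u : Fin k → F, u ≠ 0 →
      (Finset.univ.filter fun E => K ≤ (Z E u).card).card * q ^ k ≤
        2 ^ Fintype.card (ECols s δ ⊕ Fin a × Fin (δ - 1)) *
          q ^ (k * Fintype.card (ECols s δ)) := by
    intro u hu
    have hsub : (Finset.univ.filter fun E => K ≤ (Z E u).card) ⊆
        (Finset.univ.filter fun T : Finset (ECols s δ ⊕ Fin a × Fin (δ - 1)) =>
          K ≤ T.card).biUnion fun T => Finset.univ.filter fun E : Fin k → ECols s δ → F =>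
            ∀ c ∈ T, Matrix.vecMul u (matrixG (Matrix.of E) B) c = 0 := by
      intro E hE
      simp only [Finset.mem_biUnion, Finset.mem_filter, Finset.mem_univ, true_and] at hE ⊢
      exact ⟨Z E u, hE, fun c hc => by simpa [Z] using hc⟩
    calc _ ≤ (∑ T ∈ Finset.univ.filter fun T : Finset (ECols s δ ⊕ Fin a × Fin (δ - 1)) =>
            K ≤ T.card, (Finset.univ.filter fun E : Fin k → ECols s δ → F =>
            ∀ c ∈ T, Matrix.vecMul u (matrixG (Matrix.of E) B) c = 0).card) * q ^ k :=
          Nat.mul_le_mul_right _ ((Finset.card_le_card hsub).trans Finset.card_biUnion_le)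
      _ ≤ (Finset.univ.filter fun T : Finset (ECols s δ ⊕ Fin a × Fin (δ - 1)) =>
            K ≤ T.card).card • q ^ (k * Fintype.card (ECols s δ)) := by
          rw [Finset.sum_mul]
          exact Finset.sum_le_card_nsmul _ _ _ fun T hT =>
            card_vecMul_matrixG_eq_zero_mul_le hmono hz hB hu (Finset.mem_filter.1 hT).2
      _ ≤ _ := by
          rw [smul_eq_mul]
          refine Nat.mul_le_mul_right _ ((Finset.card_le_univ _).trans ?_)
          rw [Fintype.card_finset]
  have hdouble : (Finset.univ.filter fun E : Fin k → ECols s δ → F => IsBad B K E).card * (q - 1)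
      ≤ ∑ u ∈ Finset.univ.filter (fun u : Fin k → F => u ≠ 0),
        (Finset.univ.filter fun E => K ≤ (Z E u).card).card := by
    calc _ ≤ ∑ E ∈ Finset.univ.filter (fun E : Fin k → ECols s δ → F => IsBad B K E),
          ((Finset.univ.filter fun u : Fin k → F => u ≠ 0).filter
            fun u => K ≤ (Z E u).card).card := by
          rw [← smul_eq_mul]
          exact Finset.card_nsmul_le_sum _ _ _ fun E hE => hlow E (Finset.mem_filter.1 hE).2
      _ ≤ ∑ E, ((Finset.univ.filter fun u : Fin k → F => u ≠ 0).filter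
            fun u => K ≤ (Z E u).card).card :=
          Finset.sum_le_sum_of_subset (Finset.subset_univ _)
      _ = _ := Finset.sum_card_bipartiteAbove_eq_sum_card_bipartiteBelow
          (fun E u => K ≤ (Z E u).card)
  refine Nat.le_of_mul_le_mul_right (c := q ^ k) ?_ (pow_pos hq0 _)
  calc _ ≤ (∑ u ∈ Finset.univ.filter (fun u : Fin k → F => u ≠ 0),
        (Finset.univ.filter fun E => K ≤ (Z E u).card).card) * q ^ k :=
        Nat.mul_le_mul_right _ hdouble
    _ ≤ (Finset.univ.filter (fun u : Fin k → F => u ≠ 0)).card •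
        (2 ^ Fintype.card (ECols s δ ⊕ Fin a × Fin (δ - 1)) *
          q ^ (k * Fintype.card (ECols s δ))) := by
        rw [Finset.sum_mul]
        exact Finset.sum_le_card_nsmul _ _ _ fun u hu => hup u (Finset.mem_filter.1 hu).2
    _ ≤ q ^ k • (2 ^ Fintype.card (ECols s δ ⊕ Fin a × Fin (δ - 1)) *
          q ^ (k * Fintype.card (ECols s δ))) := by
        rw [smul_eq_mul, smul_eq_mul]
        refine Nat.mul_le_mul_right _ ((Finset.card_le_univ _).trans ?_)
        simp [hq]
    _ = _ := by rw [smul_eq_mul, mul_comm]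

/-! ### Uniform random matrices -/

/-- Independent uniform entries have a uniform joint distribution. -/
lemma measureReal_mem_eq_card_div {κ F Ω : Type*} [Fintype κ] [Fintype F]
    [MeasurableSpace F] [MeasurableSingletonClass F] [MeasurableSpace Ω] {P : Measure Ω}
    [IsProbabilityMeasure P] {x : κ → Ω → F} (hx : ∀ p, Measurable (x p))
    (hunif : ∀ p, P.map (x p) = uniformOn Set.univ) (hind : iIndepFun x P)
    (S : Finset (κ → F)) :
    P.real {ω | (fun p => x p ω) ∈ S} = S.card / (Fintype.card F : ℝ) ^ Fintype.card κ := by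
  classical
  have hX : Measurable fun ω p => x p ω := measurable_pi_lambda _ hx
  have hpoint : ∀ e : κ → F, P.real ((fun ω p => x p ω) ⁻¹' {e}) =
      ((Fintype.card F : ℝ) ^ Fintype.card κ)⁻¹ := by
    intro e
    have h1 : (fun ω p => x p ω) ⁻¹' {e} = ⋂ p ∈ Finset.univ, x p ⁻¹' {e p} := by
      ext ω
      simp [funext_iff]
    have h2 : ∀ p, P (x p ⁻¹' {e p}) = (Fintype.card F : ENNReal)⁻¹ := by
      intro p
      rw [← Measure.map_apply (hx p) (measurableSet_singleton _), hunif, uniformOn_univ]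
      simp
    rw [measureReal_def, h1,
      hind.measure_inter_preimage_eq_mul Finset.univ (fun p _ => measurableSet_singleton _)]
    simp [h2]
  have h3 : {ω | (fun p => x p ω) ∈ S} = ⋃ e ∈ S, (fun ω p => x p ω) ⁻¹' {e} := by
    ext ω
    simp
  rw [h3, measureReal_biUnion_finset]
  · simp [hpoint, div_eq_mul_inv]
  · intro e _ e' _ hne
    exact Disjoint.preimage _ (by simpa using hne)
  · exact fun e _ => hX (measurableSet_singleton e)

/-! ### Good matrices generate the code -/

/-- If `E` is not bad, the rows of `G` are a basis of a code with the required parameters. -/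
lemma exists_isLinearLRC_of_not_isBad {n k r δ a z : ℕ} {s : Fin a → ℕ}
    (hδ : 2 ≤ δ) (hk0 : 0 < k) (hn : n = ∑ j, s j)
    (hs : ∀ j, δ ≤ s j ∧ s j ≤ r + δ - 1) (hK : k + z * (δ - 1) ≤ n)
    {F : Type*} [Field F] [DecidableEq F]
    {B : (j : Fin a) → Matrix (Fin (s j - δ + 1)) (Fin (δ - 1)) F}
    (hB : ∀ j, AllSquareSubmatricesInvertible (B j))
    {E : Fin k → ECols s δ → F} (hE : ¬ IsBad B (k + z * (δ - 1)) E) :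
    ∃ (C : Submodule F (ECols s δ ⊕ Fin a × Fin (δ - 1) → F)) (d : ℕ),
      IsGeneratorMatrix (matrixG (Matrix.of E) B) C ∧ IsLinearLRC C n k d r δ ∧
      (n : ℤ) - k - z * ((δ : ℤ) - 1) + 1 ≤ d := by
  classical
  have hcard : Fintype.card (ECols s δ ⊕ Fin a × Fin (δ - 1)) = n := by
    rw [Fintype.card_sum, Fintype.card_sigma, Fintype.card_prod, hn]
    simp only [Fintype.card_fin]
    exact sum_blockSize_add (fun j => (hs j).1) (by omega)
  set G := matrixG (Matrix.of E) B with hG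
  have hzeros : ∀ u : Fin k → F, u ≠ 0 →
      (Finset.univ.filter fun c => Matrix.vecMul u G c = 0).card < k + z * (δ - 1) := by
    intro u hu
    by_contra! h
    exact hE ⟨u, hu, h⟩
  have hweight : ∀ u : Fin k → F, u ≠ 0 →
      n - (k + z * (δ - 1)) + 1 ≤ hammingNorm (Matrix.vecMul u G) := by
    intro u hu
    have h1 := hzeros u hu
    have h2 := Finset.card_filter_add_card_filter_not
      (s := (Finset.univ : Finset (ECols s δ ⊕ Fin a × Fin (δ - 1))))
      (fun c => Matrix.vecMul u G c = 0)
    rw [Finset.card_univ, hcard] at h2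
    simp only [hammingNorm, ne_eq]
    omega
  have hlin : LinearIndependent F G.row := by
    rw [← Matrix.vecMul_injective_iff, ← Matrix.coe_vecMulLinear, ← LinearMap.ker_eq_bot,
      LinearMap.ker_eq_bot']
    intro u hu
    by_contra hne
    have := hweight u hne
    rw [show Matrix.vecMul u G = 0 from hu, hammingNorm_zero] at this
    omega
  have hmem : ∀ c ∈ Submodule.span F (Set.range G.row), ∃ u, Matrix.vecMul u G = c := by
    intro c hc
    obtain ⟨u, rfl⟩ := (Submodule.mem_span_range_iff_exists_fun F).1 hc
    exact ⟨u, Matrix.vecMul_eq_sum u G⟩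
  have hdist : ((n - (k + z * (δ - 1)) + 1 : ℕ) : ℕ∞) ≤
      minDist (Submodule.span F (Set.range G.row) : Set (ECols s δ ⊕ Fin a × Fin (δ - 1) → F)) := by
    refine le_iInf₂ fun v hv => le_iInf₂ fun v' hv' => le_iInf fun hne => ?_
    obtain ⟨u, rfl⟩ := hmem v hv
    obtain ⟨u', rfl⟩ := hmem v' hv'
    rw [hammingDist_eq_hammingNorm, neg_add_eq_sub, ← Matrix.sub_vecMul]
    refine Nat.cast_le.2 (hweight _ fun h => hne ?_)
    rw [sub_eq_zero.1 h]
  -- The minimum distance is finite because the code has a nonzero word, for instance a row of `G`.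
  have hfin : minDist (Submodule.span F (Set.range G.row) :
      Set (ECols s δ ⊕ Fin a × Fin (δ - 1) → F)) ≠ ⊤ := by
    have h1 : G.row ⟨0, hk0⟩ ∈ Submodule.span F (Set.range G.row) :=
      Submodule.subset_span ⟨_, rfl⟩
    refine ne_top_of_le_ne_top (ENat.natCast_ne_top (hammingDist (G.row ⟨0, hk0⟩) 0)) ?_
    exact (iInf₂_le _ h1).trans ((iInf₂_le _ (Submodule.zero_mem _)).trans
      (iInf_le _ (hlin.ne_zero _)))
  obtain ⟨d, hd⟩ := ENat.ne_top_iff_exists.1 hfin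
  refine ⟨_, d, ⟨hlin, rfl⟩, ⟨hcard, ?_, hd.symm,
    hasLocality_matrixG hδ hs (Matrix.of E) hB hmem⟩, ?_⟩
  · rw [finrank_span_eq_card hlin, Fintype.card_fin]
  · rw [← hd, Nat.cast_le] at hdist
    have h1 : ((δ - 1 : ℕ) : ℤ) = (δ : ℤ) - 1 := by omega
    have h2 : ((n - (k + z * (δ - 1)) : ℕ) : ℤ) = n - k - z * ((δ : ℤ) - 1) := by
      rw [Nat.cast_sub hK]; push_cast [h1]; ring
    have h3 : ((n - (k + z * (δ - 1)) + 1 : ℕ) : ℤ) ≤ d := by exact_mod_cast hdist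
    rw [Nat.cast_add, h2] at h3
    simpa using h3

theorem theorem4p1 (n k r δ a : ℕ) (s : Fin a → ℕ)
    (hδ : 2 ≤ δ) (ha : 0 < a) (hrk : r < k) (hk : k + a * (δ - 1) ≤ n)
    (hmono : Monotone s) (hn : n = ∑ j, s j)
    (hs : ∀ j, δ ≤ s j ∧ s j ≤ r + δ - 1) :
    ∃ z : ℕ, (IsBlockThreshold s δ k z ∧ ∀ z' : ℕ, IsBlockThreshold s δ k z' → z' = z) ∧
      ∀ ε : ℝ, 0 < ε → ∃ Q : ℕ,
        ∀ (F : Type*) [Field F] [Fintype F] [DecidableEq F]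
          [MeasurableSpace F] [MeasurableSingletonClass F],
          Q ≤ Fintype.card F →
        ∀ B : (j : Fin a) → Matrix (Fin (s j - δ + 1)) (Fin (δ - 1)) F,
          (∀ j, AllSquareSubmatricesInvertible (B j)) →
        ∀ (Ω : Type*) [MeasurableSpace Ω] (P : Measure Ω) [IsProbabilityMeasure P]
          (x : Fin k → ECols s δ → Ω → F),
          (∀ i c, Measurable (x i c)) →
          (∀ i c, P.map (x i c) = uniformOn Set.univ) →
          iIndepFun (fun p : Fin k × ECols s δ => x p.1 p.2) P →
        1 - ε ≤ P.real {ω | ∃ (C : Submodule F (ECols s δ ⊕ Fin a × Fin (δ - 1) → F)) (d : ℕ),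
          IsGeneratorMatrix (matrixG (Matrix.of fun i c => x i c ω) B) C ∧
          IsLinearLRC C n k d r δ ∧
          (n : ℤ) - k - z * ((δ : ℤ) - 1) + 1 ≤ d} := by
  have hsum : ∑ j, (s j - δ + 1) + a * (δ - 1) = n := by
    rw [hn]
    exact sum_blockSize_add (fun j => (hs j).1) (by omega)
  obtain ⟨z, hza, hz, hzu⟩ := existsUnique_isBlockThreshold (s := s) (δ := δ) (k := k) (by omega)
  refine ⟨z, ⟨hz, hzu⟩, fun ε hε => ?_⟩
  obtain ⟨N, hN⟩ := exists_nat_gt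
    ((2 : ℝ) ^ Fintype.card (ECols s δ ⊕ Fin a × Fin (δ - 1)) / ε)
  refine ⟨N + 2, fun F _ _ _ _ _ hq B hB Ω _ P _ x hx hunif hind => ?_⟩
  classical
  have hK : k + z * (δ - 1) ≤ n := by
    have := Nat.mul_le_mul_right (δ - 1) hza.le
    omega
  let bad : Finset (Fin k → ECols s δ → F) :=
    Finset.univ.filter fun E => IsBad B (k + z * (δ - 1)) E
  have hbad_card : (bad.card : ℝ) * ((Fintype.card F : ℝ) - 1) ≤
      2 ^ Fintype.card (ECols s δ ⊕ Fin a × Fin (δ - 1)) *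
        (Fintype.card F : ℝ) ^ (k * Fintype.card (ECols s δ)) := by
    have h := card_isBad_mul_le hmono hz hB
    have h1 : ((Fintype.card F - 1 : ℕ) : ℝ) = (Fintype.card F : ℝ) - 1 := by
      rw [Nat.cast_sub (by omega), Nat.cast_one]
    rw [← h1]
    exact_mod_cast h
  have hprob : P.real {ω | (fun i c => x i c ω) ∈ bad} =
      bad.card / (Fintype.card F : ℝ) ^ (k * Fintype.card (ECols s δ)) := by
    have h := measureReal_mem_eq_card_div (x := fun p : Fin k × ECols s δ => x p.1 p.2)
      (fun p => hx p.1 p.2) (fun p => hunif p.1 p.2) hind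
      (bad.map (Equiv.curry (Fin k) (ECols s δ) F).symm.toEmbedding)
    rw [Finset.card_map, Fintype.card_prod, Fintype.card_fin] at h
    rw [← h]
    congr 1
    ext ω
    simp only [Set.mem_ofPred_eq, Finset.mem_map_equiv, Equiv.symm_symm]
    rfl
  have hqN : (N : ℝ) + 2 ≤ Fintype.card F := by exact_mod_cast hq
  have hε_bad : P.real {ω | (fun i c => x i c ω) ∈ bad} ≤ ε := by
    have hpos : (0 : ℝ) < Fintype.card F := by positivity
    rw [hprob, div_le_iff₀ (by positivity)]
    rw [div_lt_iff₀ hε] at hN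
    have hq1 : (0 : ℝ) < (Fintype.card F : ℝ) - 1 := by
      have : (0 : ℝ) ≤ N := N.cast_nonneg
      linarith
    refine le_of_mul_le_mul_right (hbad_card.trans ?_) hq1
    calc _ ≤ (((Fintype.card F : ℝ) - 1) * ε) *
          (Fintype.card F : ℝ) ^ (k * Fintype.card (ECols s δ)) := by
          refine mul_le_mul_of_nonneg_right (hN.le.trans ?_) (by positivity)
          exact mul_le_mul_of_nonneg_right (by linarith) hε.le
      _ = _ := by ring
  have hmeas : MeasurableSet {ω | (fun i c => x i c ω) ∈ bad} := by
    have hX : Measurable fun ω i c => x i c ω :=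
      measurable_pi_lambda _ fun i => measurable_pi_lambda _ fun c => hx i c
    exact hX bad.measurableSet
  calc 1 - ε ≤ 1 - P.real {ω | (fun i c => x i c ω) ∈ bad} := by linarith
    _ = P.real {ω | (fun i c => x i c ω) ∈ bad}ᶜ := (probReal_compl_eq_one_sub hmeas).symm
    _ ≤ _ := by
      refine measureReal_mono fun ω hω => ?_
      exact exists_isLinearLRC_of_not_isBad hδ (by omega) hn hs hK hB
        (E := fun i c => x i c ω) (by simpa [bad] using hω)
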